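/- Let $G$ be a finite group with center $Z(G)$ and commutator subgroup $G'$, and let $\hat G=\mathrm{Hom}(G,\mathbb{C}^*)$. Let $f\in Z^2(G,\mathbb{C}^*)$ be a $2$-cocycle (for the trivial action of $G$ on $\mathbb{C}^*$), and let $\mathbb{C}^fG$ be the twisted group algebra, i.e. the associative $\mathbb{C}$-algebra with basis $\{u_g\}_{g\in G}$ and multiplication $u_xu_y=f(x,y)u_{xy}$. Let $G$ act on $\mathbb{C}^fG$ by $g(a)=u_g\,a\,u_g^{-1}$, and let $\mathrm{Sz}(\mathbb{C}^fG)$ be the semi-center of $\mathbb{C}^fG$, i.e. the subalgebra which is the linear span of all semi-invariants: the nonzero elements $a$ for which there is $\lambda\in\hat G$ with $g(a)=\lambda(g)a$ for all $g\in G$. Suppose that $f$ is nondegenerate, that is, that $\mathbb{C}^fG$ is a simple algebra, and that $\mathrm{Sz}(\mathbb{C}^fG)$ is commutative. Then $|Z(G)|\le\sqrt{|G|}$. If moreover $|Z(G)|=\sqrt{|G|}$, then $G'=Z(G)$, and $Z(G)\cong\hat G$ as groups. -/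

import Mathlib

/-- A 2-cocycle `f ∈ Z²(G, ℂˣ)` of `G` with values in `ℂˣ`, with trivial action; no
normalization is assumed. -/
@[ext]
structure TwoCocycle (G : Type*) [Group G] where
  /-- The value `f(x, y)`. -/
  val : G → G → ℂˣ
  val_mul : ∀ x y z : G, val (x * y) z * val x y = val y z * val x (y * z)

namespace TwoCocycle

variable {G : Type*} [Group G]

theorem val_one_left (f : TwoCocycle G) (x : G) : f.val 1 x = f.val 1 1 := by
  have h := f.val_mul 1 1 x
  simpa using h.symm

theorem val_one_right (f : TwoCocycle G) (x : G) : f.val x 1 = f.val 1 1 := by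
  have h := f.val_mul x 1 1
  simpa using h

end TwoCocycle

/-- The twisted group algebra `ℂ^f G`: the complex vector space with basis `(u g)_{g ∈ G}`,
with the bilinear multiplication determined by `u x * u y = f(x, y) u (x * y)`. -/
def TwistedGroupAlgebra {G : Type*} [Group G] (_f : TwoCocycle G) : Type _ := G →₀ ℂ

namespace TwistedGroupAlgebra

variable {G : Type*} [Group G] {f : TwoCocycle G}

noncomputable instance : AddCommGroup (TwistedGroupAlgebra f) :=
  inferInstanceAs (AddCommGroup (G →₀ ℂ))

noncomputable instance : Module ℂ (TwistedGroupAlgebra f) :=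
  inferInstanceAs (Module ℂ (G →₀ ℂ))

/-- The element `r u_x`. -/
noncomputable def single (f : TwoCocycle G) (x : G) (r : ℂ) : TwistedGroupAlgebra f :=
  Finsupp.single x r

/-- The basis element `u_x`. -/
noncomputable def u (f : TwoCocycle G) (x : G) : TwistedGroupAlgebra f := single f x 1

noncomputable instance : Mul (TwistedGroupAlgebra f) where
  mul a b := Finsupp.sum (α := G) (M := ℂ) a fun x r => Finsupp.sum (α := G) (M := ℂ) b fun y s =>
    single f (x * y) (r * s * (f.val x y : ℂ))

/-- The identity of `ℂ^f G` is `f(1, 1)⁻¹ u_1`. -/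
noncomputable instance : One (TwistedGroupAlgebra f) where
  one := single f 1 (((f.val 1 1)⁻¹ : ℂˣ) : ℂ)

theorem mul_def (a b : TwistedGroupAlgebra f) :
    a * b = Finsupp.sum (α := G) (M := ℂ) a fun x r => Finsupp.sum (α := G) (M := ℂ) b fun y s =>
      single f (x * y) (r * s * (f.val x y : ℂ)) := rfl

theorem one_def : (1 : TwistedGroupAlgebra f) = single f 1 (((f.val 1 1)⁻¹ : ℂˣ) : ℂ) := rfl

theorem single_zero (x : G) : single f x 0 = 0 := Finsupp.single_zero x

theorem single_add (x : G) (r s : ℂ) : single f x (r + s) = single f x r + single f x s :=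
  Finsupp.single_add x r s

theorem smul_single (c : ℂ) (x : G) (r : ℂ) : c • single f x r = single f x (c * r) :=
  Finsupp.smul_single c x r

theorem mul_add' (a b c : TwistedGroupAlgebra f) : a * (b + c) = a * b + a * c := by
  simp only [mul_def]
  refine (Finset.sum_congr rfl fun x _ => ?_).trans Finset.sum_add_distrib
  exact Finsupp.sum_add_index' (fun y => by simp [single_zero])
    (fun y s t => by rw [← single_add]; ring_nf)

theorem add_mul' (a b c : TwistedGroupAlgebra f) : (a + b) * c = a * c + b * c := by
  simp only [mul_def]
  refine Finsupp.sum_add_index' (fun x => ?_) (fun x r s => ?_)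
  · exact Finset.sum_eq_zero fun y _ => by simp [single_zero]
  · refine (Finset.sum_congr rfl fun y _ => ?_).trans Finset.sum_add_distrib
    rw [← single_add]; ring_nf

theorem zero_mul' (a : TwistedGroupAlgebra f) : 0 * a = 0 := by
  have h := add_mul' 0 0 a
  simpa using h

theorem mul_zero' (a : TwistedGroupAlgebra f) : a * 0 = 0 := by
  have h := mul_add' a 0 0
  simpa using h

theorem single_mul_single (x y : G) (r s : ℂ) :
    single f x r * single f y s = single f (x * y) (r * s * (f.val x y : ℂ)) := by
  rw [mul_def]
  refine (Finsupp.sum_single_index ?_).trans (Finsupp.sum_single_index ?_)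
  · exact Finset.sum_eq_zero fun y _ => by simp [single_zero]
  · simp [single_zero]

@[elab_as_elim]
theorem induction {p : TwistedGroupAlgebra f → Prop} (a : TwistedGroupAlgebra f) (h0 : p 0)
    (hs : ∀ x r, p (single f x r)) (ha : ∀ a b, p a → p b → p (a + b)) : p a :=
  Finsupp.induction_linear (motive := p) a h0 (fun a b => ha a b) hs

noncomputable instance : Ring (TwistedGroupAlgebra f) where
  __ := (inferInstance : AddCommGroup (TwistedGroupAlgebra f))
  mul := (· * ·)
  one := 1
  left_distrib := mul_add'
  right_distrib := add_mul'
  zero_mul := zero_mul'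
  mul_zero := mul_zero'
  mul_assoc a b c := by
    induction a using induction with
    | h0 => simp only [zero_mul']
    | ha a a' h h' => simp only [add_mul', h, h']
    | hs x r =>
      induction b using induction with
      | h0 => simp only [zero_mul', mul_zero']
      | ha b b' h h' => simp only [add_mul', mul_add', h, h']
      | hs y s =>
        induction c using induction with
        | h0 => simp only [mul_zero']
        | ha c c' h h' => simp only [mul_add', h, h']
        | hs z t =>
          simp only [single_mul_single, mul_assoc]
          have h := congrArg (Units.val) (f.val_mul x y z)
          simp only [Units.val_mul] at h
          congr 1
          linear_combination (r * s * t) * h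
  one_mul a := by
    induction a using induction with
    | h0 => simp only [mul_zero']
    | ha a a' h h' => simp only [mul_add', h, h']
    | hs x r =>
      rw [one_def, single_mul_single, one_mul, f.val_one_left x]
      congr 1
      rw [mul_right_comm, Units.inv_mul, one_mul]
  mul_one a := by
    induction a using induction with
    | h0 => simp only [zero_mul']
    | ha a a' h h' => simp only [add_mul', h, h']
    | hs x r =>
      rw [one_def, single_mul_single, mul_one, f.val_one_right x]
      congr 1
      rw [mul_assoc, Units.inv_mul, mul_one]

theorem smul_mul' (c : ℂ) (a b : TwistedGroupAlgebra f) : c • a * b = c • (a * b) := by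
  induction a using induction with
  | h0 => simp
  | ha a a' h h' => simp only [smul_add, add_mul, h, h']
  | hs x r =>
    induction b using induction with
    | h0 => simp
    | ha b b' h h' => simp only [smul_add, mul_add, h, h']
    | hs y s => simp only [smul_single, single_mul_single, mul_assoc]

theorem mul_smul' (c : ℂ) (a b : TwistedGroupAlgebra f) : a * c • b = c • (a * b) := by
  induction a using induction with
  | h0 => simp
  | ha a a' h h' => simp only [smul_add, add_mul, h, h']
  | hs x r =>
    induction b using induction with
    | h0 => simp
    | ha b b' h h' => simp only [smul_add, mul_add, h, h']
    | hs y s =>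
      simp only [smul_single, single_mul_single]
      congr 1
      ring

noncomputable instance : Algebra ℂ (TwistedGroupAlgebra f) :=
  Algebra.ofModule smul_mul' mul_smul'

theorem u_mul_u (x y : G) : u f x * u f y = (f.val x y : ℂ) • u f (x * y) := by
  simp [u, single_mul_single, smul_single]

/-- The scalar multiple of `u (x⁻¹)` which is the inverse of `u x`. -/
noncomputable def uInv (f : TwoCocycle G) (x : G) : TwistedGroupAlgebra f :=
  single f x⁻¹ (((f.val 1 1)⁻¹ * (f.val x x⁻¹)⁻¹ : ℂˣ) : ℂ)

theorem val_inv (f : TwoCocycle G) (x : G) : f.val x⁻¹ x = f.val x x⁻¹ := by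
  have h := f.val_mul x x⁻¹ x
  rw [mul_inv_cancel, inv_mul_cancel, f.val_one_left x, f.val_one_right x, mul_comm] at h
  exact (mul_right_cancel h).symm

theorem u_mul_uInv (x : G) : u f x * uInv f x = 1 := by
  rw [u, uInv, single_mul_single, one_def, mul_inv_cancel, one_mul, ← Units.val_mul,
    inv_mul_cancel_right]

theorem uInv_mul_u (x : G) : uInv f x * u f x = 1 := by
  rw [u, uInv, single_mul_single, one_def, inv_mul_cancel, mul_one, val_inv, ← Units.val_mul,
    inv_mul_cancel_right]

/-- The basis element `u_x` as an invertible element of `ℂ^f G`. -/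
noncomputable def uUnit (f : TwoCocycle G) (x : G) : (TwistedGroupAlgebra f)ˣ :=
  ⟨u f x, uInv f x, u_mul_uInv x, uInv_mul_u x⟩

theorem conj_one (a : TwistedGroupAlgebra f) : u f 1 * a * (↑(uUnit f 1)⁻¹ : _) = a := by
  have h1 : u f 1 = (f.val 1 1 : ℂ) • (1 : TwistedGroupAlgebra f) := by
    rw [u, one_def, smul_single, Units.mul_inv]
  have h : u f 1 * a = a * u f 1 := by
    rw [h1, smul_mul_assoc, mul_smul_comm, one_mul, mul_one]
  rw [h, mul_assoc]
  exact (congrArg (a * ·) (u_mul_uInv 1)).trans (mul_one a)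

theorem conj_mul (x y : G) (a : TwistedGroupAlgebra f) :
    u f (x * y) * a * (↑(uUnit f (x * y))⁻¹ : _) =
      u f x * (u f y * a * (↑(uUnit f y)⁻¹ : _)) * (↑(uUnit f x)⁻¹ : _) := by
  have e : ∀ z, u f z = (uUnit f z : TwistedGroupAlgebra f) := fun _ => rfl
  rw [Units.mul_inv_eq_iff_eq_mul]
  have hne : (f.val x y : ℂ) ≠ 0 := (f.val x y).ne_zero
  have h : u f (x * y) = (f.val x y : ℂ)⁻¹ • (u f x * u f y) := by
    rw [u_mul_u, inv_smul_smul₀ hne]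
  rw [← e, h, mul_smul_comm, smul_mul_assoc]
  congr 1
  simp only [e, mul_assoc, Units.inv_mul_cancel_left, Units.inv_mul, mul_one]

/-- The conjugation action of `G` on `ℂ^f G`: `g • a = u_g a u_g⁻¹`. -/
noncomputable instance : MulSemiringAction G (TwistedGroupAlgebra f) where
  smul x a := u f x * a * (↑(uUnit f x)⁻¹ : TwistedGroupAlgebra f)
  one_smul := conj_one
  mul_smul := conj_mul
  smul_zero x := by
    change u f x * 0 * _ = 0
    rw [mul_zero, zero_mul]
  smul_add x a b := by
    change u f x * (a + b) * _ = u f x * a * _ + u f x * b * _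
    rw [mul_add, add_mul]
  smul_one x := by
    change u f x * 1 * _ = 1
    rw [mul_one]
    exact u_mul_uInv x
  smul_mul x a b := by
    change u f x * (a * b) * _ = (u f x * a * _) * (u f x * b * _)
    have e : u f x = (uUnit f x : TwistedGroupAlgebra f) := rfl
    simp only [e, mul_assoc, Units.inv_mul_cancel_left]

theorem smul_def (x : G) (a : TwistedGroupAlgebra f) :
    x • a = u f x * a * (↑(uUnit f x)⁻¹ : TwistedGroupAlgebra f) := rfl

instance : SMulCommClass G ℂ (TwistedGroupAlgebra f) where
  smul_comm x c a := by
    simp only [smul_def, mul_smul_comm, smul_mul_assoc]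

end TwistedGroupAlgebra

/-- `a` is a semi-invariant of the `G`-module algebra `A` over `K`: it is nonzero and there is a
character `χ : G → Kˣ` with `g • a = χ(g) a` for all `g`. -/
def IsSemiInvariant (K G : Type*) {A : Type*} [Field K] [Group G] [Ring A] [Algebra K A]
    [MulSemiringAction G A] [SMulCommClass G K A] (a : A) : Prop :=
  a ≠ 0 ∧ ∃ χ : G →* Kˣ, ∀ g : G, g • a = (χ g : K) • a

theorem IsSemiInvariant.mul_mem {K G A : Type*} [Field K] [Group G] [Ring A] [Algebra K A]
    [MulSemiringAction G A] [SMulCommClass G K A] {a b : A}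
    (ha : a ∈ Submodule.span K {a : A | IsSemiInvariant K G a})
    (hb : b ∈ Submodule.span K {a : A | IsSemiInvariant K G a}) :
    a * b ∈ Submodule.span K {a : A | IsSemiInvariant K G a} := by
  have h := Submodule.mul_mem_mul ha hb
  rw [Submodule.span_mul_span] at h
  refine (Submodule.span_le.2 ?_) h
  rintro _ ⟨a, ⟨_, χ, hχ⟩, b, ⟨_, ψ, hψ⟩, rfl⟩
  by_cases h0 : a * b = 0
  · simp [h0]
  · refine Submodule.subset_span ⟨h0, χ * ψ, fun g => ?_⟩
    simp only [smul_mul', hχ, hψ, smul_mul_assoc, mul_smul_comm, smul_smul, MonoidHom.mul_apply,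
      Units.val_mul]
    rw [mul_comm]

theorem IsSemiInvariant.one_mem (K G A : Type*) [Field K] [Group G] [Ring A] [Algebra K A]
    [MulSemiringAction G A] [SMulCommClass G K A] :
    (1 : A) ∈ Submodule.span K {a : A | IsSemiInvariant K G a} := by
  by_cases h0 : (1 : A) = 0
  · simp [h0]
  · exact Submodule.subset_span ⟨h0, 1, fun g => by simp⟩

/-- The semi-center of a `G`-module algebra `A` over `K`: the span of the semi-invariants, which
is a subalgebra of `A`. -/
def semiCenter (K G A : Type*) [Field K] [Group G] [Ring A] [Algebra K A]
    [MulSemiringAction G A] [SMulCommClass G K A] : Subalgebra K A :=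
  (Submodule.span K {a : A | IsSemiInvariant K G a}).toSubalgebra
    (IsSemiInvariant.one_mem K G A) (fun _ _ => IsSemiInvariant.mul_mem)

/-- A 2-cocycle `f` is nondegenerate if the twisted group algebra `ℂ^f G` is simple. -/
def TwoCocycle.IsNondegenerate {G : Type*} [Group G] (f : TwoCocycle G) : Prop :=
  IsSimpleRing (TwistedGroupAlgebra f)

/-! Write Ĝ for the character group. Two upper bounds for |Z(G)| multiply to |Ĝ| · |G'| = |G|. For
central z, conjugation by u_g only rescales u_z, so u_z is a semi-invariant whose weight is a
character of G. The resulting homomorphism Z(G) → Ĝ is injective because the center of the simple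
algebra ℂ^f G is ℂ (`weightHom_injective`). Hence |Z(G)| ≤ |Ĝ|. Conversely, u_g ↦ χ(g) u_g is an
automorphism for every χ in Ĝ, inner by Skolem-Noether, so every χ is the weight of some unit w
(`exists_unit_smul_eq`). If the semi-center is commutative, u_z commutes with w, which forces χ(z) =
1 for all χ. Hence Z(G) ≤ G' (`center_le_commutator`). Equality in the product forces equality in
both bounds. -/

/-- The **Skolem-Noether theorem** for finite-dimensional simple algebras over an algebraically
closed field: every automorphism is inner. -/
theorem AlgEquiv.exists_units_mul_eq_mul_of_isAlgClosed {K A : Type*} [Field K] [IsAlgClosed K]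
    [Ring A] [Algebra K A] [IsSimpleRing A] [FiniteDimensional K A] (σ : A ≃ₐ[K] A) :
    ∃ w : Aˣ, ∀ a : A, w * a = σ a * w := by
  obtain ⟨n, _, ⟨e⟩⟩ := IsSimpleRing.exists_algEquiv_matrix_of_isAlgClosed K A
  let e' : A ≃ₐ[K] Module.End K (Fin n → K) := e.trans Matrix.toLinAlgEquiv'
  -- Automorphisms of a full endomorphism algebra are conjugations by linear automorphisms; T,
  -- pulled back along e', gives w.
  obtain ⟨T, hT⟩ := ((e'.symm.trans σ).trans e').eq_linearEquivConjAlgEquiv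
  let w : (Module.End K (Fin n → K))ˣ := (LinearMap.GeneralLinearGroup.ofLinearEquiv T)
  refine ⟨Units.map (e'.symm : _ →* A) w, fun a => e'.injective ?_⟩
  have h := congrArg (fun φ => φ (e' a)) hT
  simp only [AlgEquiv.trans_apply, AlgEquiv.symm_apply_apply] at h
  rw [map_mul, map_mul, h]
  refine LinearMap.ext fun x => ?_
  simp [w, LinearEquiv.conjAlgEquiv_apply]

/-- A finite-dimensional simple algebra over an algebraically closed field is central. -/
theorem IsSimpleRing.isCentral_of_isAlgClosed (K A : Type*) [Field K] [IsAlgClosed K]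
    [Ring A] [Algebra K A] [IsSimpleRing A] [FiniteDimensional K A] : Algebra.IsCentral K A := by
  obtain ⟨n, _, ⟨e⟩⟩ := IsSimpleRing.exists_algEquiv_matrix_of_isAlgClosed K A
  refine ⟨fun a ha => ?_⟩
  have h : e a ∈ Subalgebra.center K (Matrix (Fin n) (Fin n) K) :=
    Subalgebra.mem_center_iff.2 fun b => by
      rw [← e.apply_symm_apply b, ← map_mul, ← map_mul, Subalgebra.mem_center_iff.1 ha]
  obtain ⟨c, hc⟩ := Algebra.IsCentral.out h
  exact ⟨c, e.injective ((e.commutes c).trans hc)⟩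

/-! ### Characters of a finite group -/

/-- Characters factor through the abelianization, and a finite abelian group has as many complex
characters as elements. -/
theorem card_monoidHom_units_complex (G : Type*) [Group G] [Finite G] :
    Nat.card (G →* ℂˣ) = Nat.card (Abelianization G) := by
  rw [Nat.card_congr (Abelianization.lift (G := G) (A := ℂˣ))]
  exact CommGroup.card_monoidHom_of_hasEnoughRootsOfUnity _ ℂ

/-- Characters of the finite abelian group G/G' separate its points. -/
theorem mem_commutator_of_forall_monoidHom_eq_one {G : Type*} [Group G] [Finite G] {x : G}
    (hx : ∀ χ : G →* ℂˣ, χ x = 1) : x ∈ commutator G := by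
  rw [← Abelianization.ker_of, MonoidHom.mem_ker]
  by_contra h
  obtain ⟨χ, hχ⟩ := CommGroup.exists_apply_ne_one_of_hasEnoughRootsOfUnity _ ℂ h
  exact hχ (hx (χ.comp Abelianization.of))

namespace TwistedGroupAlgebra

variable {G : Type*} [Group G] {f : TwoCocycle G}

instance [Finite G] : FiniteDimensional ℂ (TwistedGroupAlgebra f) :=
  inferInstanceAs (FiniteDimensional ℂ (G →₀ ℂ))

theorem u_ne_zero (x : G) : u f x ≠ 0 :=
  Finsupp.single_ne_zero.2 one_ne_zero

theorem single_eq_smul_u (x : G) (r : ℂ) : single f x r = r • u f x := by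
  rw [u, smul_single, mul_one]

theorem smul_eq_iff {x : G} {a b : TwistedGroupAlgebra f} :
    x • a = b ↔ u f x * a = b * u f x := by
  rw [smul_def, Units.mul_inv_eq_iff_eq_mul]
  rfl

theorem eq_one_of_u_eq_algebraMap {x : G} {c : ℂ} (h : algebraMap ℂ _ c = u f x) : x = 1 := by
  by_contra hx
  rw [Algebra.algebraMap_eq_smul_one, one_def, smul_single] at h
  -- Compare coefficients at x: 0 on the scalar side since x ≠ 1, but 1 in u_x.
  have := DFunLike.congr_fun (F := G →₀ ℂ) h x
  simp [single, u, Ne.symm hx] at this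

/-! ### Every character is a weight -/

/-- The linear endomorphism `u_x ↦ χ(x) u_x` of `ℂ^f G`. -/
noncomputable def twistLinear (f : TwoCocycle G) (χ : G →* ℂˣ) :
    TwistedGroupAlgebra f →ₗ[ℂ] TwistedGroupAlgebra f :=
  Finsupp.lsum (M := ℂ) ℂ fun x : G =>
    LinearMap.toSpanSingleton ℂ (TwistedGroupAlgebra f) ((χ x : ℂ) • u f x)

theorem twistLinear_single (χ : G →* ℂˣ) (x : G) (r : ℂ) :
    twistLinear f χ (single f x r) = single f x (r * χ x) := by
  refine (Finsupp.lsum_single (M := ℂ) ℂ (fun x : G =>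
    LinearMap.toSpanSingleton ℂ (TwistedGroupAlgebra f) ((χ x : ℂ) • u f x)) x r).trans ?_
  simp [u, smul_single]

/-- The linear endomorphism `u_x ↦ χ(x) u_x` as an algebra endomorphism. -/
noncomputable def twist (f : TwoCocycle G) (χ : G →* ℂˣ) :
    TwistedGroupAlgebra f →ₐ[ℂ] TwistedGroupAlgebra f :=
  AlgHom.ofLinearMap (twistLinear f χ)
    (by rw [one_def, twistLinear_single, map_one, Units.val_one, mul_one])
    (fun a b => by
      induction a using induction with
      | h0 => simp
      | ha a a' h h' => simp only [add_mul, map_add, h, h']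
      | hs x r =>
        induction b using induction with
        | h0 => simp
        | ha b b' h h' => simp only [mul_add, map_add, h, h']
        | hs y s =>
          simp only [single_mul_single, twistLinear_single, map_mul, Units.val_mul]
          congr 1
          ring)

theorem twist_u (χ : G →* ℂˣ) (x : G) : twist f χ (u f x) = (χ x : ℂ) • u f x := by
  refine (twistLinear_single χ x 1).trans ?_
  rw [one_mul, single_eq_smul_u]

theorem twist_comp_twist {χ ψ : G →* ℂˣ} (h : χ * ψ = 1) :
    (twist f χ).comp (twist f ψ) = AlgHom.id ℂ _ := by
  ext a
  induction a using induction with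
  | h0 => simp
  | ha a b ha hb => rw [map_add, map_add, ha, hb]
  | hs x r =>
    have hx : (ψ x : ℂ) * χ x = 1 := by
      rw [mul_comm, ← Units.val_mul, ← MonoidHom.mul_apply, h, MonoidHom.one_apply, Units.val_one]
    rw [single_eq_smul_u, map_smul, map_smul, AlgHom.comp_apply, twist_u, map_smul, twist_u,
      smul_smul, smul_smul, mul_assoc, hx, mul_one, AlgHom.id_apply]

/-- The action of a character of `G` on `ℂ^f G` by `u_x ↦ χ(x) u_x`. -/
noncomputable def twistEquiv (f : TwoCocycle G) (χ : G →* ℂˣ) :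
    TwistedGroupAlgebra f ≃ₐ[ℂ] TwistedGroupAlgebra f :=
  AlgEquiv.ofAlgHom (twist f χ) (twist f χ⁻¹) (twist_comp_twist (mul_inv_cancel χ))
    (twist_comp_twist (inv_mul_cancel χ))

/-- If `ℂ^f G` is simple, then every character of `G` is the weight of an invertible element. -/
theorem exists_unit_smul_eq [Finite G] (hf : f.IsNondegenerate) (χ : G →* ℂˣ) :
    ∃ w : (TwistedGroupAlgebra f)ˣ, ∀ g : G,
      g • (w : TwistedGroupAlgebra f) = (χ g : ℂ) • (w : TwistedGroupAlgebra f) := by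
  have : IsSimpleRing (TwistedGroupAlgebra f) := hf
  -- The inverse is needed: w u_g = χ(g)⁻¹ u_g w says that u_g w u_g⁻¹ = χ(g) w.
  obtain ⟨w, hw⟩ := (twistEquiv f χ⁻¹).exists_units_mul_eq_mul_of_isAlgClosed
  refine ⟨w, fun g => smul_eq_iff.2 ?_⟩
  have h : twistEquiv f χ⁻¹ (u f g) = ((χ⁻¹) g : ℂ) • u f g := twist_u _ _
  rw [smul_mul_assoc, hw, h, smul_mul_assoc, smul_smul, MonoidHom.inv_apply, Units.mul_inv,
    one_smul]

/-! ### Weights of central basis elements -/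

theorem smul_u_center_eq_div_smul (z : Subgroup.center G) (g : G) :
    g • u f z = ((f.val g z / f.val z g : ℂˣ) : ℂ) • u f z := by
  have hz : (z : G) * g = g * z := (Subgroup.mem_center_iff.1 z.2 g).symm
  rw [smul_eq_iff, smul_mul_assoc, u_mul_u, u_mul_u, hz, smul_smul, ← Units.val_mul,
    div_mul_cancel]

/-- The weight of `u_z` for `z` in the center of `G`. -/
noncomputable def weight (f : TwoCocycle G) (z : Subgroup.center G) : G →* ℂˣ :=
  MonoidHom.mk' (fun g => f.val g z / f.val z g) fun x y => by
    apply Units.ext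
    -- Scalars are compared through their action on the nonzero vector u_z, so multiplicativity
    -- comes from the group action rather than from cocycle identities.
    apply smul_left_injective ℂ (u_ne_zero (f := f) (z : G))
    dsimp only
    rw [← smul_u_center_eq_div_smul, mul_smul, smul_u_center_eq_div_smul z y, smul_comm, smul_u_center_eq_div_smul z x,
      smul_smul, ← Units.val_mul, mul_comm]

theorem smul_u_center (z : Subgroup.center G) (g : G) :
    g • u f z = (weight f z g : ℂ) • u f z :=
  smul_u_center_eq_div_smul z g

theorem isSemiInvariant_u_center (z : Subgroup.center G) : IsSemiInvariant ℂ G (u f z) :=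
  ⟨u_ne_zero _, weight f z, smul_u_center z⟩

/-- The homomorphism from the center of `G` to its character group given by the weights. -/
noncomputable def weightHom (f : TwoCocycle G) : Subgroup.center G →* (G →* ℂˣ) :=
  MonoidHom.mk' (weight f) fun z z' => by
    ext g
    apply smul_left_injective ℂ (u_ne_zero (f := f) ((z * z' : Subgroup.center G) : G))
    dsimp only
    rw [← smul_u_center]
    -- G acts by algebra automorphisms, so the weight of a product is the product of the weights.
    have h : u f ((z * z' : Subgroup.center G) : G) =
        (f.val z z' : ℂ)⁻¹ • (u f (z : G) * u f (z' : G)) := by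
      rw [u_mul_u, inv_smul_smul₀ (Units.ne_zero _)]
      rfl
    rw [h, smul_comm, MulSemiringAction.smul_mul, smul_u_center, smul_u_center, smul_mul_smul_comm,
      smul_comm]
    rfl

theorem weightHom_apply (z : Subgroup.center G) : weightHom f z = weight f z := rfl

/-- Being fixed by g means commuting with u_g, and the u_g span the algebra. -/
theorem mem_center_of_forall_smul_eq {a : TwistedGroupAlgebra f} (h : ∀ g : G, g • a = a) :
    a ∈ Subalgebra.center ℂ (TwistedGroupAlgebra f) := by
  rw [Subalgebra.mem_center_iff]
  intro b
  induction b using induction with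
  | h0 => simp
  | ha b b' h h' => rw [add_mul, mul_add, h, h']
  | hs x r =>
    rw [single_eq_smul_u, smul_mul_assoc, smul_eq_iff.1 (h x), mul_smul_comm]

/-- If the weight of u_z is trivial, u_z is central, hence a scalar, which forces z = 1. -/
theorem weightHom_injective [Finite G] (hf : f.IsNondegenerate) :
    Function.Injective (weightHom f) := by
  have : IsSimpleRing (TwistedGroupAlgebra f) := hf
  have := IsSimpleRing.isCentral_of_isAlgClosed ℂ (TwistedGroupAlgebra f)
  rw [injective_iff_map_eq_one]
  intro z hz
  have hmem : u f (z : G) ∈ Subalgebra.center ℂ (TwistedGroupAlgebra f) :=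
    mem_center_of_forall_smul_eq fun g => by
      rw [smul_u_center, ← weightHom_apply, hz, MonoidHom.one_apply, Units.val_one, one_smul]
  obtain ⟨c, hc⟩ := Algebra.IsCentral.out hmem
  exact Subtype.ext (eq_one_of_u_eq_algebraMap hc)

/-- If `ℂ^f G` is simple with commutative semi-center, then the center of `G` lies in its
commutator subgroup. -/
theorem center_le_commutator [Finite G] (hf : f.IsNondegenerate)
    (hcomm : ∀ a ∈ semiCenter ℂ G (TwistedGroupAlgebra f),
      ∀ b ∈ semiCenter ℂ G (TwistedGroupAlgebra f), a * b = b * a) :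
    Subgroup.center G ≤ commutator G := by
  have : IsSimpleRing (TwistedGroupAlgebra f) := hf
  intro z hz
  refine mem_commutator_of_forall_monoidHom_eq_one fun χ => ?_
  obtain ⟨w, hw⟩ := exists_unit_smul_eq hf χ
  -- Both u_z and w lie in the semi-center, so they commute; thus z fixes w, while it also scales w
  -- by χ(z).
  have h : z • (w : TwistedGroupAlgebra f) = w :=
    smul_eq_iff.2 <| hcomm _ (Submodule.subset_span (isSemiInvariant_u_center ⟨z, hz⟩)) _
      (Submodule.subset_span ⟨w.ne_zero, χ, hw⟩)
  apply Units.ext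
  apply smul_left_injective ℂ w.ne_zero
  dsimp only
  rw [← hw, h, Units.val_one, one_smul]

end TwistedGroupAlgebra

open TwistedGroupAlgebra in
theorem mainTheorem7 {G : Type*} [Group G] [Finite G] (f : TwoCocycle G)
    (hf : f.IsNondegenerate)
    (hcomm : ∀ a ∈ semiCenter ℂ G (TwistedGroupAlgebra f),
      ∀ b ∈ semiCenter ℂ G (TwistedGroupAlgebra f), a * b = b * a) :
    (Nat.card (Subgroup.center G) : ℝ) ≤ Real.sqrt (Nat.card G) ∧
    ((Nat.card (Subgroup.center G) : ℝ) = Real.sqrt (Nat.card G) →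
      commutator G = Subgroup.center G ∧
        Nonempty (Subgroup.center G ≃* (G →* ℂˣ))) := by
  have hle := center_le_commutator hf hcomm
  have hfin : Finite (G →* ℂˣ) := Nat.finite_of_card_ne_zero <| by
    rw [card_monoidHom_units_complex]; exact Nat.card_pos.ne'
  have h1 : Nat.card (Subgroup.center G) ≤ Nat.card (G →* ℂˣ) :=
    Nat.card_le_card_of_injective _ (weightHom_injective hf)
  have h2 : Nat.card (Subgroup.center G) ≤ Nat.card (commutator G) := Subgroup.card_le_of_le hle
  have h3 : Nat.card G = Nat.card (G →* ℂˣ) * Nat.card (commutator G) := by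
    rw [card_monoidHom_units_complex]
    exact Subgroup.card_eq_card_quotient_mul_card_subgroup _
  have hpos : 0 < Nat.card (Subgroup.center G) := Nat.card_pos
  refine ⟨Real.le_sqrt_of_sq_le ?_, fun h => ?_⟩
  · rw [h3, sq]
    exact_mod_cast Nat.mul_le_mul h1 h2
  · have h4 : Nat.card (Subgroup.center G) * Nat.card (Subgroup.center G) =
        Nat.card (G →* ℂˣ) * Nat.card (commutator G) := by
      rw [← h3, ← Nat.cast_inj (R := ℝ), Nat.cast_mul, h, Real.mul_self_sqrt (Nat.cast_nonneg _)]
    -- |Z| · |G'| ≤ |Ĝ| · |G'| = |Z|², then cancel |Z|; `h6` is symmetric.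
    have h5 : Nat.card (commutator G) ≤ Nat.card (Subgroup.center G) :=
      Nat.le_of_mul_le_mul_left ((Nat.mul_le_mul_right _ h1).trans h4.ge) hpos
    have h6 : Nat.card (G →* ℂˣ) ≤ Nat.card (Subgroup.center G) :=
      Nat.le_of_mul_le_mul_right ((Nat.mul_le_mul_left _ h2).trans h4.ge) hpos
    refine ⟨(Subgroup.eq_of_le_of_card_ge hle h5).symm, ⟨MulEquiv.ofBijective (weightHom f) ?_⟩⟩
    exact (Nat.bijective_iff_injective_and_card _).2 ⟨weightHom_injective hf, h1.antisymm h6⟩
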